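/- \textbf{Logic and languages.} Let $\mathcal L_\in$ be the one-sorted first-order language with $\in$ and equality, and let $\mathcal L^2_\in$ be the two-sorted language with set variables $x,y,\dots$ and class variables $X,Y,\dots$, with atomic formulas $x=y$, $x\in y$, $X=Y$, $x\in X$, set quantifiers $\forall^0,\exists^0$ and class quantifiers $\forall^1,\exists^1$. Provability is in intuitionistic (one- or two-sorted) first-order logic with equality. Free variables of axioms are universally quantified; schemes allow finitely many parameters. \textbf{First-order theories.} $\mathsf{CZF}$ has the axioms Extensionality, Pairing, Union, Infinity ($\exists w\,\forall u\,[u\in w\leftrightarrow u=\varnothing\vee\exists v\in w\,(u=v\cup\{v\})]$) and, for all formulas $\phi$ of $\mathcal L_\in$: $\in$-Induction $[\forall x(\forall y\in x\,\phi(y)\to\phi(x))]\to\forall x\,\phi(x)$; $\Delta_0$-Separation (for bounded $\phi$) $\forall a\exists b\forall x[x\in b\leftrightarrow x\in a\wedge\phi(x)]$; Strong Collection $\forall a[\forall x\in a\exists y\,\phi(x,y)\to\exists b(\forall x\in a\exists y\in b\,\phi(x,y)\wedge\forall y\in b\exists x\in a\,\phi(x,y))]$; Subset Collection $\forall a\forall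 b\exists c\forall u[\forall x\in a\exists y\in b\,\phi(x,y,u)\to\exists d\in c(\forall x\in a\exists y\in d\,\phi(x,y,u)\wedge\forall y\in d\exists x\in a\,\phi(x,y,u))]$. $\mathsf{IZF}$ has the axioms Extensionality, Pairing, Union, Infinity, Powerset and, for all formulas $\phi$ of $\mathcal L_\in$, $\in$-Induction, Separation, and Collection $\forall a[\forall x\in a\exists y\,\phi(x,y)\to\exists b\,\forall x\in a\exists y\in b\,\phi(x,y)]$. \textbf{Second-order theories.} $\mathsf{CGB}$ is the $\mathcal L^2_\in$-theory with the axioms of $\mathsf{CZF}$ (schemes only for formulas of $\mathcal L_\in$) and: Class Extensionality $\forall^1X,Y[X=Y\leftrightarrow\forall^0x(x\in X\leftrightarrow x\in Y)]$; Elementary Comprehension $\exists^1A\,\forall^0x[x\in A\leftrightarrow\phi(x)]$ for every $\phi$ without class quantifiers, possibly with set and class parameters, in which $A$ is not free; Class Set Induction $\forall^1A[\forall^0x(\forall^0y\in x\,(y\in A)\to x\in A)\to\forall^0x(x\in A)]$; Class Strong Collection $\forall^1R\,\forall^0a[\forall^0x\in a\,\exists^0y\,\langle x,y\rangle\in R\to\exists^0b(\forall^0x\in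 a\,\exists^0y\in b\,\langle x,y\rangle\in R\wedge\forall^0y\in b\,\exists^0x\in a\,\langle x,y\rangle\in R)]$. $\mathsf{IGB}$ is obtained from $\mathsf{CGB}$ by adding the axioms of $\mathsf{IZF}$ and Class Separation $\forall^1A\,\forall^0a\,\exists^0b\,\forall^0x[x\in b\leftrightarrow x\in A\wedge x\in a]$, and replacing Class Strong Collection by Class Collection $\forall^1R\,\forall^0a[\forall^0x\in a\,\exists^0y\,\langle x,y\rangle\in R\to\exists^0b\,\forall^0x\in a\,\exists^0y\in b\,\langle x,y\rangle\in R]$. \textbf{Proposition.} $\mathsf{IGB}$ is a conservative extension of $\mathsf{IZF}$, and $\mathsf{CGB}$ is a conservative extension of $\mathsf{CZF}$: for every formula $\phi$ of $\mathcal L_\in$, $\mathsf{IGB}\vdash\phi$ if and only if $\mathsf{IZF}\vdash\phi$, and $\mathsf{CGB}\vdash\phi$ if and only if $\mathsf{CZF}\vdash\phi$. Consequently $\mathsf{IGB}$ and $\mathsf{IZF}$ have the same proof-theoretic strength, and so do $\mathsf{CGB}$ and $\mathsf{CZF}$, in the sense that the two theories are equiconsistent and prove the same sentences of first-order arithmetic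 (interpreted in set theory on $\omega$ in the standard way). -/

import Mathlib

namespace CST

/-! ### Variables

Both languages are purely relational, so the only terms are variables and substitution is renaming
of variables. Variables are de Bruijn indices: a quantifier binds the index `0` of its scope and
the index `n + 1` in the scope is the index `n` outside it. -/

/-- The action of a renaming below one more quantifier. -/
def up (ρ : ℕ → ℕ) : ℕ → ℕ
  | 0 => 0
  | n + 1 => ρ n + 1

/-- The substitution of the variable `t` for the variable `0`. -/
def inst (t : ℕ) : ℕ → ℕ
  | 0 => t
  | n + 1 => n

/-- `vars [i₀, …, iₘ₋₁] k` sends the variables `0, …, m - 1` to `i₀, …, iₘ₋₁`, and `m, m + 1, …`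
to `k, k + 1, …`. It places a formula `φ(x₀, …, xₘ₋₁, parameters)` under `k` quantifiers, using
bound variables for `x₀, …, xₘ₋₁` and leaving the parameters free. -/
def vars (l : List ℕ) (k : ℕ) (i : ℕ) : ℕ :=
  l.getD i (i - l.length + k)

/-! ### The first-order language of set theory and intuitionistic logic with equality -/

/-- Formulas of the one-sorted first-order language `⟨∈⟩` with equality. -/
inductive SetFormula : Type
  | bot : SetFormula
  | eq (x y : ℕ) : SetFormula
  | mem (x y : ℕ) : SetFormula
  | and (φ ψ : SetFormula) : SetFormula
  | or (φ ψ : SetFormula) : SetFormula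
  | imp (φ ψ : SetFormula) : SetFormula
  | all (φ : SetFormula) : SetFormula
  | ex (φ : SetFormula) : SetFormula

namespace SetFormula

def iff (φ ψ : SetFormula) : SetFormula := and (imp φ ψ) (imp ψ φ)

/-- `∀ x ∈ a, φ`, where `x` is the variable `0` of `φ` and `a` is a variable outside. -/
def allIn (a : ℕ) (φ : SetFormula) : SetFormula := all (imp (mem 0 (a + 1)) φ)

/-- `∃ x ∈ a, φ`, where `x` is the variable `0` of `φ` and `a` is a variable outside. -/
def exIn (a : ℕ) (φ : SetFormula) : SetFormula := ex (and (mem 0 (a + 1)) φ)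

def rename : (ℕ → ℕ) → SetFormula → SetFormula
  | _, bot => bot
  | ρ, eq x y => eq (ρ x) (ρ y)
  | ρ, mem x y => mem (ρ x) (ρ y)
  | ρ, and φ ψ => and (rename ρ φ) (rename ρ ψ)
  | ρ, or φ ψ => or (rename ρ φ) (rename ρ ψ)
  | ρ, imp φ ψ => imp (rename ρ φ) (rename ρ ψ)
  | ρ, all φ => all (rename (up ρ) φ)
  | ρ, ex φ => ex (rename (up ρ) φ)

/-- Natural deduction for intuitionistic first-order logic with equality: `Proves T Γ φ` says that
`φ` is derivable from the axioms `T` and the open assumptions `Γ`. In the quantifier rules the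
shift of `Γ` is the eigenvariable condition. The axioms are not shifted, so that an axiom with free
variables stands for its universal closure. -/
inductive Proves (T : Set SetFormula) : List SetFormula → SetFormula → Prop
  | ax {Γ φ} : φ ∈ T → Proves T Γ φ
  | hyp {Γ φ} : φ ∈ Γ → Proves T Γ φ
  | botE {Γ φ} : Proves T Γ bot → Proves T Γ φ
  | andI {Γ φ ψ} : Proves T Γ φ → Proves T Γ ψ → Proves T Γ (and φ ψ)
  | andE₁ {Γ φ ψ} : Proves T Γ (and φ ψ) → Proves T Γ φ
  | andE₂ {Γ φ ψ} : Proves T Γ (and φ ψ) → Proves T Γ ψ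
  | orI₁ {Γ φ ψ} : Proves T Γ φ → Proves T Γ (or φ ψ)
  | orI₂ {Γ φ ψ} : Proves T Γ ψ → Proves T Γ (or φ ψ)
  | orE {Γ φ ψ χ} : Proves T Γ (or φ ψ) → Proves T (φ :: Γ) χ → Proves T (ψ :: Γ) χ →
      Proves T Γ χ
  | impI {Γ φ ψ} : Proves T (φ :: Γ) ψ → Proves T Γ (imp φ ψ)
  | impE {Γ φ ψ} : Proves T Γ (imp φ ψ) → Proves T Γ φ → Proves T Γ ψ
  | allI {Γ φ} : Proves T (Γ.map (rename Nat.succ)) φ → Proves T Γ (all φ)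
  | allE {Γ φ} (t : ℕ) : Proves T Γ (all φ) → Proves T Γ (rename (inst t) φ)
  | exI {Γ φ} (t : ℕ) : Proves T Γ (rename (inst t) φ) → Proves T Γ (ex φ)
  | exE {Γ φ ψ} : Proves T Γ (ex φ) →
      Proves T (φ :: Γ.map (rename Nat.succ)) (rename Nat.succ ψ) → Proves T Γ ψ
  | eqI {Γ} (t : ℕ) : Proves T Γ (eq t t)
  | eqE {Γ φ s t} : Proves T Γ (eq s t) → Proves T Γ (rename (inst s) φ) →
      Proves T Γ (rename (inst t) φ)

/-- Bounded (`Δ₀`) formulas. -/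
inductive IsBounded : SetFormula → Prop
  | bot : IsBounded bot
  | eq (x y : ℕ) : IsBounded (eq x y)
  | mem (x y : ℕ) : IsBounded (mem x y)
  | and {φ ψ} : IsBounded φ → IsBounded ψ → IsBounded (and φ ψ)
  | or {φ ψ} : IsBounded φ → IsBounded ψ → IsBounded (or φ ψ)
  | imp {φ ψ} : IsBounded φ → IsBounded ψ → IsBounded (imp φ ψ)
  | allIn {φ} (a : ℕ) : IsBounded φ → IsBounded (allIn a φ)
  | exIn {φ} (a : ℕ) : IsBounded φ → IsBounded (exIn a φ)

/-! #### Abbreviations for set-theoretic notions -/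

/-- `x = ∅`. -/
def isEmpty (x : ℕ) : SetFormula := all (imp (mem 0 (x + 1)) bot)

/-- `x ⊆ y`. -/
def sub (x y : ℕ) : SetFormula := allIn x (mem 0 (y + 1))

/-- `z = {x, y}`. -/
def isUPair (z x y : ℕ) : SetFormula :=
  all (iff (mem 0 (z + 1)) (or (eq 0 (x + 1)) (eq 0 (y + 1))))

/-- `p = ⟨x, y⟩ = {{x}, {x, y}}`. -/
def isOPair (p x y : ℕ) : SetFormula :=
  all (iff (mem 0 (p + 1)) (or (isUPair 0 (x + 1) (x + 1)) (isUPair 0 (x + 1) (y + 1))))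

/-- `⟨x, y⟩ ∈ g`. -/
def pairMem (x y g : ℕ) : SetFormula :=
  ex (and (isOPair 0 (x + 1) (y + 1)) (mem 0 (g + 1)))

/-- `y = x ∪ {x}`. -/
def isSucc (y x : ℕ) : SetFormula :=
  all (iff (mem 0 (y + 1)) (or (mem 0 (x + 1)) (eq 0 (x + 1))))

/-- `w = ω`, in the form `∀ u, u ∈ w ↔ u = ∅ ∨ ∃ v ∈ w, u = v ∪ {v}`. -/
def isOmega (w : ℕ) : SetFormula :=
  all (iff (mem 0 (w + 1)) (or (isEmpty 0) (exIn (w + 1) (isSucc 1 0))))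

/-! #### Axioms of first-order set theory

Schemes are given for a formula `φ` whose variables `0, 1, …` are the displayed arguments
`x, y, …` and whose other variables are parameters. -/

/-- `∀ a b, (∀ x, x ∈ a ↔ x ∈ b) → a = b`. -/
def extensionality : SetFormula :=
  all (all (imp (all (iff (mem 0 2) (mem 0 1))) (eq 1 0)))

/-- `∀ a b, ∃ c, c = {a, b}`. -/
def pairing : SetFormula := all (all (ex (isUPair 0 2 1)))

/-- `∀ a, ∃ c, ∀ x, x ∈ c ↔ ∃ y ∈ a, x ∈ y`. -/
def union : SetFormula := all (ex (all (iff (mem 0 1) (exIn 2 (mem 1 0)))))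

/-- `∃ w, w = ω`. -/
def infinity : SetFormula := ex (isOmega 0)

/-- `∀ a, ∃ c, ∀ x, x ∈ c ↔ x ⊆ a`. -/
def powerset : SetFormula := all (ex (all (iff (mem 0 1) (sub 0 2))))

/-- `(∀ x, (∀ y ∈ x, φ(y)) → φ(x)) → ∀ x, φ(x)`. -/
def setInduction (φ : SetFormula) : SetFormula :=
  imp (all (imp (allIn 0 (φ.rename (vars [0] 2))) (φ.rename (vars [0] 1))))
    (all (φ.rename (vars [0] 1)))

/-- `∀ a, ∃ b, ∀ x, x ∈ b ↔ x ∈ a ∧ φ(x)`. -/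
def separation (φ : SetFormula) : SetFormula :=
  all (ex (all (iff (mem 0 1) (and (mem 0 2) (φ.rename (vars [0] 3))))))

/-- `∀ a, (∀ x ∈ a, ∃ y, φ(x, y)) → ∃ b, ∀ x ∈ a, ∃ y ∈ b, φ(x, y)`. -/
def collection (φ : SetFormula) : SetFormula :=
  all (imp (allIn 0 (ex (φ.rename (vars [1, 0] 3))))
    (ex (allIn 1 (exIn 1 (φ.rename (vars [1, 0] 4))))))

/-- `∀ a, (∀ x ∈ a, ∃ y, φ(x, y)) →
  ∃ b, (∀ x ∈ a, ∃ y ∈ b, φ(x, y)) ∧ (∀ y ∈ b, ∃ x ∈ a, φ(x, y))`. -/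
def strongCollection (φ : SetFormula) : SetFormula :=
  all (imp (allIn 0 (ex (φ.rename (vars [1, 0] 3))))
    (ex (and (allIn 1 (exIn 1 (φ.rename (vars [1, 0] 4))))
      (allIn 0 (exIn 2 (φ.rename (vars [0, 1] 4)))))))

/-- `∀ a b, ∃ c, ∀ u, (∀ x ∈ a, ∃ y ∈ b, φ(x, y, u)) →
  ∃ d ∈ c, (∀ x ∈ a, ∃ y ∈ d, φ(x, y, u)) ∧ (∀ y ∈ d, ∃ x ∈ a, φ(x, y, u))`. -/
def subsetCollection (φ : SetFormula) : SetFormula :=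
  all (all (ex (all (imp
    (allIn 3 (exIn 3 (φ.rename (vars [1, 0, 2] 6))))
    (exIn 1 (and
      (allIn 4 (exIn 1 (φ.rename (vars [1, 0, 3] 7))))
      (allIn 0 (exIn 5 (φ.rename (vars [0, 1, 3] 7))))))))))

end SetFormula

open SetFormula in
/-- The axioms of Intuitionistic Zermelo–Fraenkel set theory. -/
def IZF : Set SetFormula :=
  {extensionality, pairing, union, infinity, powerset} ∪
    {ψ | ∃ φ, ψ = setInduction φ} ∪
    {ψ | ∃ φ, ψ = separation φ} ∪
    {ψ | ∃ φ, ψ = collection φ}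

open SetFormula in
/-- The axioms of Constructive Zermelo–Fraenkel set theory. -/
def CZF : Set SetFormula :=
  {extensionality, pairing, union, infinity} ∪
    {ψ | ∃ φ, ψ = setInduction φ} ∪
    {ψ | ∃ φ, IsBounded φ ∧ ψ = separation φ} ∪
    {ψ | ∃ φ, ψ = strongCollection φ} ∪
    {ψ | ∃ φ, ψ = subsetCollection φ}

/-! ### The two-sorted language of sets and classes -/

/-- Formulas of the two-sorted language. Set variables and class variables are indexed separately;
`all0`, `ex0` quantify over sets and `all1`, `ex1` over classes. `eqC X Y` is equality of classes
and `memC x X` is membership of a set in a class. -/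
inductive ClassFormula : Type
  | bot : ClassFormula
  | eq (x y : ℕ) : ClassFormula
  | mem (x y : ℕ) : ClassFormula
  | eqC (X Y : ℕ) : ClassFormula
  | memC (x X : ℕ) : ClassFormula
  | and (φ ψ : ClassFormula) : ClassFormula
  | or (φ ψ : ClassFormula) : ClassFormula
  | imp (φ ψ : ClassFormula) : ClassFormula
  | all0 (φ : ClassFormula) : ClassFormula
  | ex0 (φ : ClassFormula) : ClassFormula
  | all1 (φ : ClassFormula) : ClassFormula
  | ex1 (φ : ClassFormula) : ClassFormula

/-- The inclusion of the first-order language in the two-sorted one. -/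
def SetFormula.toClass : SetFormula → ClassFormula
  | bot => .bot
  | eq x y => .eq x y
  | mem x y => .mem x y
  | and φ ψ => .and φ.toClass ψ.toClass
  | or φ ψ => .or φ.toClass ψ.toClass
  | imp φ ψ => .imp φ.toClass ψ.toClass
  | all φ => .all0 φ.toClass
  | ex φ => .ex0 φ.toClass

namespace ClassFormula

def iff (φ ψ : ClassFormula) : ClassFormula := and (imp φ ψ) (imp ψ φ)

/-- `∀⁰ x ∈ a, φ`, where `x` is the set variable `0` of `φ` and `a` is a set variable outside. -/
def allIn (a : ℕ) (φ : ClassFormula) : ClassFormula := all0 (imp (mem 0 (a + 1)) φ)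

/-- `∃⁰ x ∈ a, φ`, where `x` is the set variable `0` of `φ` and `a` is a set variable outside. -/
def exIn (a : ℕ) (φ : ClassFormula) : ClassFormula := ex0 (and (mem 0 (a + 1)) φ)

/-- `rename ρ σ` renames set variables by `ρ` and class variables by `σ`. -/
def rename : (ℕ → ℕ) → (ℕ → ℕ) → ClassFormula → ClassFormula
  | _, _, bot => bot
  | ρ, _, eq x y => eq (ρ x) (ρ y)
  | ρ, _, mem x y => mem (ρ x) (ρ y)
  | _, σ, eqC X Y => eqC (σ X) (σ Y)
  | ρ, σ, memC x X => memC (ρ x) (σ X)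
  | ρ, σ, and φ ψ => and (rename ρ σ φ) (rename ρ σ ψ)
  | ρ, σ, or φ ψ => or (rename ρ σ φ) (rename ρ σ ψ)
  | ρ, σ, imp φ ψ => imp (rename ρ σ φ) (rename ρ σ ψ)
  | ρ, σ, all0 φ => all0 (rename (up ρ) σ φ)
  | ρ, σ, ex0 φ => ex0 (rename (up ρ) σ φ)
  | ρ, σ, all1 φ => all1 (rename ρ (up σ) φ)
  | ρ, σ, ex1 φ => ex1 (rename ρ (up σ) φ)

/-- Natural deduction for two-sorted intuitionistic logic with equality in both sorts. As in the
one-sorted case, an axiom with free variables stands for its universal closure. -/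
inductive Proves (T : Set ClassFormula) : List ClassFormula → ClassFormula → Prop
  | ax {Γ φ} : φ ∈ T → Proves T Γ φ
  | hyp {Γ φ} : φ ∈ Γ → Proves T Γ φ
  | botE {Γ φ} : Proves T Γ bot → Proves T Γ φ
  | andI {Γ φ ψ} : Proves T Γ φ → Proves T Γ ψ → Proves T Γ (and φ ψ)
  | andE₁ {Γ φ ψ} : Proves T Γ (and φ ψ) → Proves T Γ φ
  | andE₂ {Γ φ ψ} : Proves T Γ (and φ ψ) → Proves T Γ ψ
  | orI₁ {Γ φ ψ} : Proves T Γ φ → Proves T Γ (or φ ψ)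
  | orI₂ {Γ φ ψ} : Proves T Γ ψ → Proves T Γ (or φ ψ)
  | orE {Γ φ ψ χ} : Proves T Γ (or φ ψ) → Proves T (φ :: Γ) χ → Proves T (ψ :: Γ) χ →
      Proves T Γ χ
  | impI {Γ φ ψ} : Proves T (φ :: Γ) ψ → Proves T Γ (imp φ ψ)
  | impE {Γ φ ψ} : Proves T Γ (imp φ ψ) → Proves T Γ φ → Proves T Γ ψ
  | all0I {Γ φ} : Proves T (Γ.map (rename Nat.succ id)) φ → Proves T Γ (all0 φ)
  | all0E {Γ φ} (t : ℕ) : Proves T Γ (all0 φ) → Proves T Γ (rename (inst t) id φ)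
  | ex0I {Γ φ} (t : ℕ) : Proves T Γ (rename (inst t) id φ) → Proves T Γ (ex0 φ)
  | ex0E {Γ φ ψ} : Proves T Γ (ex0 φ) →
      Proves T (φ :: Γ.map (rename Nat.succ id)) (rename Nat.succ id ψ) → Proves T Γ ψ
  | all1I {Γ φ} : Proves T (Γ.map (rename id Nat.succ)) φ → Proves T Γ (all1 φ)
  | all1E {Γ φ} (t : ℕ) : Proves T Γ (all1 φ) → Proves T Γ (rename id (inst t) φ)
  | ex1I {Γ φ} (t : ℕ) : Proves T Γ (rename id (inst t) φ) → Proves T Γ (ex1 φ)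
  | ex1E {Γ φ ψ} : Proves T Γ (ex1 φ) →
      Proves T (φ :: Γ.map (rename id Nat.succ)) (rename id Nat.succ ψ) → Proves T Γ ψ
  | eqI {Γ} (t : ℕ) : Proves T Γ (eq t t)
  | eqE {Γ φ s t} : Proves T Γ (eq s t) → Proves T Γ (rename (inst s) id φ) →
      Proves T Γ (rename (inst t) id φ)
  | eqCI {Γ} (t : ℕ) : Proves T Γ (eqC t t)
  | eqCE {Γ φ s t} : Proves T Γ (eqC s t) → Proves T Γ (rename id (inst s) φ) →
      Proves T Γ (rename id (inst t) φ)

/-- First-order formulas with class parameters: there is no class quantifier. -/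
def IsElementary : ClassFormula → Prop
  | bot | eq _ _ | mem _ _ | eqC _ _ | memC _ _ => True
  | and φ ψ | or φ ψ | imp φ ψ => φ.IsElementary ∧ ψ.IsElementary
  | all0 φ | ex0 φ => φ.IsElementary
  | all1 _ | ex1 _ => False

/-- `⟨x, y⟩ ∈ R` for sets `x`, `y` and a class `R`. -/
def pairMemC (x y R : ℕ) : ClassFormula :=
  ex0 (and (SetFormula.isOPair 0 (x + 1) (y + 1)).toClass (memC 0 R))

/-! #### Second-order axioms -/

/-- `∀¹ X Y, X = Y ↔ ∀⁰ x, x ∈ X ↔ x ∈ Y`. -/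
def classExtensionality : ClassFormula :=
  all1 (all1 (iff (eqC 1 0) (all0 (iff (memC 0 1) (memC 0 0)))))

/-- `∃¹ A, ∀⁰ x, x ∈ A ↔ φ(x)`, where `x` is the set variable `0` of `φ` and all other variables
of `φ` are set and class parameters. -/
def comprehension (φ : ClassFormula) : ClassFormula :=
  ex1 (all0 (iff (memC 0 0) (φ.rename id Nat.succ)))

/-- `∀¹ A, (∀⁰ x, (∀⁰ y ∈ x, y ∈ A) → x ∈ A) → ∀⁰ x, x ∈ A`. -/
def classSetInduction : ClassFormula :=
  all1 (imp (all0 (imp (allIn 0 (memC 0 0)) (memC 0 0))) (all0 (memC 0 0)))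

/-- `∀¹ R, ∀⁰ a, (∀⁰ x ∈ a, ∃⁰ y, ⟨x, y⟩ ∈ R) →
  ∃⁰ b, (∀⁰ x ∈ a, ∃⁰ y ∈ b, ⟨x, y⟩ ∈ R) ∧ (∀⁰ y ∈ b, ∃⁰ x ∈ a, ⟨x, y⟩ ∈ R)`. -/
def classStrongCollection : ClassFormula :=
  all1 (all0 (imp (allIn 0 (ex0 (pairMemC 1 0 0)))
    (ex0 (and (allIn 1 (exIn 1 (pairMemC 1 0 0))) (allIn 0 (exIn 2 (pairMemC 0 1 0)))))))

/-- `∀¹ A, ∀⁰ a, ∃⁰ b, ∀⁰ x, x ∈ b ↔ x ∈ A ∧ x ∈ a`. -/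
def classSeparation : ClassFormula :=
  all1 (all0 (ex0 (all0 (iff (mem 0 1) (and (memC 0 0) (mem 0 2))))))

/-- `∀¹ R, ∀⁰ a, (∀⁰ x ∈ a, ∃⁰ y, ⟨x, y⟩ ∈ R) → ∃⁰ b, ∀⁰ x ∈ a, ∃⁰ y ∈ b, ⟨x, y⟩ ∈ R`. -/
def classCollection : ClassFormula :=
  all1 (all0 (imp (allIn 0 (ex0 (pairMemC 1 0 0)))
    (ex0 (allIn 1 (exIn 1 (pairMemC 1 0 0))))))

end ClassFormula

open ClassFormula in
/-- The axioms of constructive Gödel–Bernays set theory over `CZF`. -/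
def CGB : Set ClassFormula :=
  SetFormula.toClass '' CZF ∪
    {classExtensionality, classSetInduction, classStrongCollection} ∪
    {ψ | ∃ φ, IsElementary φ ∧ ψ = comprehension φ}

open ClassFormula in
/-- The axioms of intuitionistic Gödel–Bernays set theory: those of `CGB` and `IZF` together with
Class Separation, and with Class Collection in place of Class Strong Collection. -/
def IGB : Set ClassFormula :=
  SetFormula.toClass '' (CZF ∪ IZF) ∪
    {classExtensionality, classSetInduction, classSeparation, classCollection} ∪
    {ψ | ∃ φ, IsElementary φ ∧ ψ = comprehension φ}

/-! ### First-order arithmetic and its interpretation in set theory -/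

/-- Terms of the language `0, S, +, ·` with variables among `n` many. -/
inductive ArithTerm (n : ℕ) : Type
  | var (i : Fin n) : ArithTerm n
  | zero : ArithTerm n
  | succ (t : ArithTerm n) : ArithTerm n
  | add (s t : ArithTerm n) : ArithTerm n
  | mul (s t : ArithTerm n) : ArithTerm n

/-- Formulas of first-order arithmetic with free variables among `n` many. -/
inductive ArithFormula : ℕ → Type
  | bot {n} : ArithFormula n
  | eq {n} (s t : ArithTerm n) : ArithFormula n
  | and {n} (φ ψ : ArithFormula n) : ArithFormula n
  | or {n} (φ ψ : ArithFormula n) : ArithFormula n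
  | imp {n} (φ ψ : ArithFormula n) : ArithFormula n
  | all {n} (φ : ArithFormula (n + 1)) : ArithFormula n
  | ex {n} (φ : ArithFormula (n + 1)) : ArithFormula n

namespace SetFormula

/-- `x ∈ ω`. -/
def isNat (x : ℕ) : SetFormula := ex (and (isOmega 0) (mem (x + 1) 0))

/-- Recursion along a natural number `y` with value `z`: there is a single-valued `g` with
`⟨∅, s⟩ ∈ g` for some `s` with `start(s)`; such that, if `i ∈ y` and `⟨i, u⟩ ∈ g`, then
`⟨i ∪ {i}, v⟩ ∈ g` for some `v` with `step(v, u)`; and with `⟨y, z⟩ ∈ g`. -/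
def isRec (start step : SetFormula) (y z : ℕ) : SetFormula :=
  ex (and (all (all (all (imp (and (pairMem 2 1 3) (pairMem 2 0 3)) (eq 1 0)))))
    (and (ex (ex (and (isEmpty 1) (and (start.rename (vars [0] 3)) (pairMem 1 0 2)))))
      (and (all (all (imp (and (mem 1 (y + 3)) (pairMem 1 0 2))
          (ex (ex (and (isSucc 1 3) (and (step.rename (vars [0, 2] 5)) (pairMem 1 0 4))))))))
        (pairMem (y + 1) (z + 1) 0))))

/-- `x + y = z` for natural numbers. -/
def isAdd (x y z : ℕ) : SetFormula := isRec (eq 0 (x + 1)) (isSucc 0 1) y z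

/-- `x · y = z` for natural numbers. -/
def isMul (x y z : ℕ) : SetFormula := isRec (isEmpty 0) (isAdd 1 (x + 2) 0) y z

end SetFormula

open SetFormula in
/-- The formula saying that the variable `0` is the value of the term `t`; the variable `i` of `t`
becomes the variable `i + 1`. -/
def ArithTerm.graph {n : ℕ} : ArithTerm n → SetFormula
  | var i => eq 0 (i + 1)
  | zero => isEmpty 0
  | succ t => ex (and (t.graph.rename (vars [0] 2)) (isSucc 1 0))
  | add s t => ex (ex (and (s.graph.rename (vars [1] 3))
      (and (t.graph.rename (vars [0] 3)) (isAdd 1 0 2))))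
  | mul s t => ex (ex (and (s.graph.rename (vars [1] 3))
      (and (t.graph.rename (vars [0] 3)) (isMul 1 0 2))))

open SetFormula in
/-- The standard interpretation of arithmetic in set theory, with quantifiers ranging over `ω`. -/
def ArithFormula.toSet : {n : ℕ} → ArithFormula n → SetFormula
  | _, bot => SetFormula.bot
  | _, eq s t => SetFormula.ex (SetFormula.and s.graph t.graph)
  | _, and φ ψ => SetFormula.and φ.toSet ψ.toSet
  | _, or φ ψ => SetFormula.or φ.toSet ψ.toSet
  | _, imp φ ψ => SetFormula.imp φ.toSet ψ.toSet
  | _, all φ => SetFormula.all (SetFormula.imp (isNat 0) φ.toSet)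
  | _, ex φ => SetFormula.ex (SetFormula.and (isNat 0) φ.toSet)

/-! ### Conservativity and proof-theoretic strength -/

/-- The second-order theory `S` extends the first-order theory `T` and is conservative over it:
they prove the same formulas of the language of `T`. -/
def IsConservativeOver (S : Set ClassFormula) (T : Set SetFormula) : Prop :=
  ∀ φ : SetFormula, ClassFormula.Proves S [] φ.toClass ↔ SetFormula.Proves T [] φ

/-- `S` and `T` have the same proof-theoretic strength: they are equiconsistent and prove the same
sentences of first-order arithmetic. -/
def SameStrength (S : Set ClassFormula) (T : Set SetFormula) : Prop :=
  (¬ ClassFormula.Proves S [] .bot ↔ ¬ SetFormula.Proves T [] .bot) ∧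
    ∀ φ : ArithFormula 0, ClassFormula.Proves S [] φ.toSet.toClass ↔ SetFormula.Proves T [] φ.toSet

end CST

namespace CST

/-! Classically one would expand a model of the first-order theory `T` by its definable classes.
Here the same idea is carried out proof-theoretically, by a Beth-style forcing: conditions are
finite contexts over `T`, sets are variables, and classes are first-order formulas with parameters.
No single first-order formula can express a quantifier over all definable classes, so class
quantifiers are read in the metatheory. Disjunctions and existential statements are read up to the
closure operator `Cover`, which is designed so that forcing cannot go beyond provability.

Three facts carry the argument. Forcing is sound for two-sorted intuitionistic logic
(`Proves.forces`). Forcing a formula without class quantifiers amounts to proving in `T` its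
translation with the classes replaced by their definitions (`forces_iff_proves`); this yields
Comprehension at once. The remaining class axioms, evaluated at a definable class, reduce to scheme
instances of `T`.

Hence, if the class theory proves a first-order formula, the empty context forces it under the
identity assignment, so `T` proves it. The converse is the inclusion of calculi `Proves.toClass`.
`IGB` also contains the axioms of `CZF`, so Strong and Subset Collection are derived inside the
forcing over `IZF`. Equiconsistency and agreement on arithmetic are special cases of conservativity.
-/

/-- Prepend a value to a sequence. -/
def push {α : Type*} (a : α) (s : ℕ → α) : ℕ → α
  | 0 => a
  | n + 1 => s n

@[simp] theorem push_zero {α : Type*} (a : α) (s : ℕ → α) : push a s 0 = a := rfl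

@[simp] theorem push_succ {α : Type*} (a : α) (s : ℕ → α) (n : ℕ) : push a s (n + 1) = s n := rfl

/-! ### Algebra of renamings. -/

@[simp] theorem up_zero (ρ : ℕ → ℕ) : up ρ 0 = 0 := rfl

@[simp] theorem up_succ (ρ : ℕ → ℕ) (n : ℕ) : up ρ (n + 1) = ρ n + 1 := rfl

@[simp] theorem inst_zero (t : ℕ) : inst t 0 = t := rfl

@[simp] theorem inst_succ (t n : ℕ) : inst t (n + 1) = n := rfl

@[simp] theorem up_id : up id = id := by
  funext n; cases n <;> rfl

theorem up_comp (ρ σ : ℕ → ℕ) : up ρ ∘ up σ = up (ρ ∘ σ) := by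
  funext n; cases n <;> rfl

theorem up_comp_succ (ρ : ℕ → ℕ) : up ρ ∘ Nat.succ = Nat.succ ∘ ρ := rfl

theorem inst_comp_up (t : ℕ) (ρ : ℕ → ℕ) : inst t ∘ up ρ = push t ρ := by
  funext n; cases n <;> rfl

theorem inst_comp_succ (t : ℕ) : inst t ∘ Nat.succ = id := rfl

theorem comp_inst {α : Type*} (s : ℕ → α) (t : ℕ) : s ∘ inst t = push (s t) s := by
  funext n; cases n <;> rfl

theorem push_comp_up {α : Type*} (a : α) (s : ℕ → α) (ρ : ℕ → ℕ) :
    push a s ∘ up ρ = push a (s ∘ ρ) := by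
  funext n; cases n <;> rfl

theorem push_comp_succ {α : Type*} (a : α) (s : ℕ → α) : push a s ∘ Nat.succ = s := rfl

/-! ### The one-sorted calculus: renaming of derivations and fresh variables. -/

namespace SetFormula

variable {T : Set SetFormula}

@[simp] theorem rename_id (φ : SetFormula) : φ.rename id = φ := by
  induction φ <;> simp_all [rename]

theorem rename_rename (φ : SetFormula) (ρ σ : ℕ → ℕ) :
    (φ.rename ρ).rename σ = φ.rename (σ ∘ ρ) := by
  induction φ generalizing ρ σ <;> simp_all [rename, up_comp]

/-- A formula has finitely many free variables, and renaming depends only on these. -/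
theorem exists_bound (φ : SetFormula) :
    ∃ N, ∀ ρ σ : ℕ → ℕ, (∀ i < N, ρ i = σ i) → φ.rename ρ = φ.rename σ := by
  induction φ with
  | bot => exact ⟨0, fun _ _ _ => rfl⟩
  | eq x y =>
    exact ⟨x + y + 1, fun ρ σ h => by simp [rename, h x (by omega), h y (by omega)]⟩
  | mem x y =>
    exact ⟨x + y + 1, fun ρ σ h => by simp [rename, h x (by omega), h y (by omega)]⟩
  | and φ ψ ihφ ihψ | or φ ψ ihφ ihψ | imp φ ψ ihφ ihψ =>
    obtain ⟨N, hN⟩ := ihφ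
    obtain ⟨M, hM⟩ := ihψ
    refine ⟨N + M, fun ρ σ h => ?_⟩
    simp only [rename]
    rw [hN ρ σ fun i hi => h i (by omega), hM ρ σ fun i hi => h i (by omega)]
  | all φ ih | ex φ ih =>
    obtain ⟨N, hN⟩ := ih
    refine ⟨N, fun ρ σ h => ?_⟩
    simp only [rename]
    rw [hN (up ρ) (up σ)]
    intro i hi
    cases i with
    | zero => rfl
    | succ i => simp [h i (by omega)]

theorem exists_bound_list (Γ : List SetFormula) :
    ∃ N, ∀ φ ∈ Γ, ∀ ρ σ : ℕ → ℕ, (∀ i < N, ρ i = σ i) → φ.rename ρ = φ.rename σ := by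
  induction Γ with
  | nil => exact ⟨0, by simp⟩
  | cons φ Γ ih =>
    obtain ⟨N, hN⟩ := ih
    obtain ⟨M, hM⟩ := φ.exists_bound
    refine ⟨N + M, fun ψ hψ ρ σ h => ?_⟩
    rcases List.mem_cons.1 hψ with rfl | hψ
    · exact hM ρ σ fun i hi => h i (by omega)
    · exact hN ψ hψ ρ σ fun i hi => h i (by omega)

/-- The set of axioms `T` is closed under renaming of free variables. -/
def RenameClosed (T : Set SetFormula) : Prop := ∀ φ ∈ T, ∀ ρ, rename ρ φ ∈ T

namespace Proves

theorem weaken {Γ Δ : List SetFormula} {φ : SetFormula} (h : Proves T Γ φ) (hΓ : Γ ⊆ Δ) :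
    Proves T Δ φ := by
  induction h generalizing Δ with
  | ax h => exact ax h
  | hyp h => exact hyp (hΓ h)
  | botE _ ih => exact botE (ih hΓ)
  | andI _ _ ih₁ ih₂ => exact andI (ih₁ hΓ) (ih₂ hΓ)
  | andE₁ _ ih => exact andE₁ (ih hΓ)
  | andE₂ _ ih => exact andE₂ (ih hΓ)
  | orI₁ _ ih => exact orI₁ (ih hΓ)
  | orI₂ _ ih => exact orI₂ (ih hΓ)
  | orE _ _ _ ih ih₁ ih₂ =>
    exact orE (ih hΓ) (ih₁ (List.cons_subset_cons _ hΓ)) (ih₂ (List.cons_subset_cons _ hΓ))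
  | impI _ ih => exact impI (ih (List.cons_subset_cons _ hΓ))
  | impE _ _ ih₁ ih₂ => exact impE (ih₁ hΓ) (ih₂ hΓ)
  | allI _ ih => exact allI (ih (List.map_subset _ hΓ))
  | allE t _ ih => exact allE t (ih hΓ)
  | exI t _ ih => exact exI t (ih hΓ)
  | exE _ _ ih₁ ih₂ =>
    exact exE (ih₁ hΓ) (ih₂ (List.cons_subset_cons _ (List.map_subset _ hΓ)))
  | eqI t => exact eqI t
  | eqE _ _ ih₁ ih₂ => exact eqE (ih₁ hΓ) (ih₂ hΓ)

theorem rename_inst (φ : SetFormula) (t : ℕ) (ρ : ℕ → ℕ) :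
    (φ.rename (inst t)).rename ρ = (φ.rename (up ρ)).rename (inst (ρ t)) := by
  rw [rename_rename, rename_rename, inst_comp_up, comp_inst]

theorem map_rename_succ (Γ : List SetFormula) (ρ : ℕ → ℕ) :
    (Γ.map (SetFormula.rename Nat.succ)).map (SetFormula.rename (up ρ)) =
      (Γ.map (SetFormula.rename ρ)).map (SetFormula.rename Nat.succ) := by
  simp [rename_rename, up_comp_succ]

/-- Open axioms stand for their closures, so a renamed derivation may need renamed axioms; hence the
closure hypothesis. The renaming need not be injective. -/
theorem rename (hT : RenameClosed T) {Γ : List SetFormula} {φ : SetFormula}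
    (h : Proves T Γ φ) (ρ : ℕ → ℕ) :
    Proves T (Γ.map (SetFormula.rename ρ)) (φ.rename ρ) := by
  induction h generalizing ρ with
  | ax h => exact ax (hT _ h ρ)
  | hyp h => exact hyp (List.mem_map_of_mem h)
  | botE _ ih => exact botE (ih ρ)
  | andI _ _ ih₁ ih₂ => exact andI (ih₁ ρ) (ih₂ ρ)
  | andE₁ _ ih => exact andE₁ (ih ρ)
  | andE₂ _ ih => exact andE₂ (ih ρ)
  | orI₁ _ ih => exact orI₁ (ih ρ)
  | orI₂ _ ih => exact orI₂ (ih ρ)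
  | orE _ _ _ ih ih₁ ih₂ => exact orE (ih ρ) (ih₁ ρ) (ih₂ ρ)
  | impI _ ih => exact impI (ih ρ)
  | impE _ _ ih₁ ih₂ => exact impE (ih₁ ρ) (ih₂ ρ)
  | allI _ ih =>
    refine allI ?_
    rw [← map_rename_succ]
    exact ih (up ρ)
  | allE t _ ih =>
    rw [rename_inst]
    exact allE _ (ih ρ)
  | exI t _ ih =>
    refine exI (ρ t) ?_
    rw [← rename_inst]
    exact ih ρ
  | @exE Γ φ ψ _ _ ih₁ ih₂ =>
    refine exE (ih₁ ρ) ?_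
    have := ih₂ (up ρ)
    rw [List.map_cons, map_rename_succ, rename_rename, up_comp_succ, ← rename_rename] at this
    exact this
  | eqI t => exact eqI _
  | eqE _ _ ih₁ ih₂ =>
    rw [rename_inst]
    refine eqE (ih₁ ρ) ?_
    rw [← rename_inst]
    exact ih₂ ρ

/-- A renaming that turns a fresh variable `N` into the variable `0` and shifts the others. -/
theorem exists_unshift (Γ : List SetFormula) (φ : SetFormula) :
    ∃ (N : ℕ) (ρ : ℕ → ℕ), Γ.map (SetFormula.rename ρ) = Γ.map (SetFormula.rename Nat.succ) ∧
      (φ.rename (inst N)).rename ρ = φ := by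
  obtain ⟨N, hN⟩ := exists_bound_list (φ :: Γ)
  -- `N` exceeds every free variable of `φ` and `Γ`. So on `Γ` the renaming acts as the shift, and
  -- after `inst N` it sends `0` to `N` and back to `0`, and `i + 1` to `i` and back to `i + 1`.
  refine ⟨N, fun i => if i = N then 0 else i + 1, ?_, ?_⟩
  · refine List.map_congr_left fun ψ hψ => hN ψ (List.mem_cons_of_mem _ hψ) _ _ fun i hi => ?_
    simp [hi.ne]
  · rw [rename_rename]
    conv_rhs => rw [← rename_id φ]
    refine hN φ List.mem_cons_self _ _ fun i hi => ?_
    cases i with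
    | zero => simp
    | succ i => simp [show i ≠ N by omega]

/-- The instance at one fresh variable already suffices. This turns quantification over variables in
the metatheory, as in the forcing clauses, back into a derivation; `ex_elim` does the same for `∃`.
-/
theorem all_of_forall (hT : RenameClosed T) {Γ : List SetFormula} {φ : SetFormula}
    (h : ∀ t, Proves T Γ (φ.rename (inst t))) : Proves T Γ (all φ) := by
  obtain ⟨N, ρ, hΓ, hφ⟩ := exists_unshift Γ φ
  have := (h N).rename hT ρ
  rw [hΓ, hφ] at this
  exact allI this

theorem ex_elim (hT : RenameClosed T) {Γ : List SetFormula} {φ ψ : SetFormula}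
    (h : Proves T Γ (ex φ)) (hψ : ∀ t, Proves T (φ.rename (inst t) :: Γ) ψ) : Proves T Γ ψ := by
  obtain ⟨N, ρ, hΓ, hφ⟩ := exists_unshift (ψ :: Γ) φ
  simp only [List.map_cons, List.cons.injEq] at hΓ
  have := (hψ N).rename hT ρ
  rw [List.map_cons, hΓ.2, hφ, hΓ.1] at this
  exact exE h this

theorem eq_symm {Γ : List SetFormula} {s t : ℕ} (h : Proves T Γ (eq s t)) :
    Proves T Γ (eq t s) :=
  eqE (φ := eq 0 (s + 1)) h (eqI s)

theorem eq_congr {Γ : List SetFormula} {s s' t t' : ℕ} (hs : Proves T Γ (eq s s'))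
    (ht : Proves T Γ (eq t t')) (h : Proves T Γ (eq s t)) : Proves T Γ (eq s' t') :=
  eqE (φ := eq (s' + 1) 0) ht (eqE (φ := eq 0 (t + 1)) hs h)

theorem mem_congr {Γ : List SetFormula} {s s' t t' : ℕ} (hs : Proves T Γ (eq s s'))
    (ht : Proves T Γ (eq t t')) (h : Proves T Γ (mem s t)) : Proves T Γ (mem s' t') :=
  eqE (φ := mem (s' + 1) 0) ht (eqE (φ := mem 0 (t + 1)) hs h)

theorem iff_mp {Γ : List SetFormula} {φ ψ : SetFormula} (h : Proves T Γ (iff φ ψ))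
    (hφ : Proves T Γ φ) : Proves T Γ ψ :=
  impE (andE₁ h) hφ

theorem iff_mpr {Γ : List SetFormula} {φ ψ : SetFormula} (h : Proves T Γ (iff φ ψ))
    (hψ : Proves T Γ ψ) : Proves T Γ φ :=
  impE (andE₂ h) hψ

theorem iff_intro {Γ : List SetFormula} {φ ψ : SetFormula} (h₁ : Proves T (φ :: Γ) ψ)
    (h₂ : Proves T (ψ :: Γ) φ) : Proves T Γ (iff φ ψ) :=
  andI (impI h₁) (impI h₂)

end Proves

end SetFormula

/-! ### Forcing

Conditions are finite contexts of a first-order theory, sets are variables, and classes are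
formulas whose variable `0` is the element and whose variable `i + 1` is the set `i`. -/

open SetFormula (Proves RenameClosed)

/-- `Γ` proves every formula that is provable from all the extensions of `Γ` in `S`, hereditarily
in `Γ`. -/
def Cover (T : Set SetFormula) (Γ : List SetFormula) (S : List SetFormula → Prop) : Prop :=
  ∀ Δ, Γ ⊆ Δ → ∀ χ, (∀ Θ, Δ ⊆ Θ → S Θ → Proves T Θ χ) → Proves T Δ χ

namespace Cover

variable {T : Set SetFormula} {Γ Δ : List SetFormula} {S S' : List SetFormula → Prop}

theorem mono (h : Cover T Γ S) (hΓ : Γ ⊆ Δ) : Cover T Δ S :=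
  fun Θ hΘ => h Θ (List.Subset.trans hΓ hΘ)

theorem imp (h : Cover T Γ S) (hS : ∀ Δ, Γ ⊆ Δ → S Δ → S' Δ) : Cover T Γ S' :=
  fun Δ hΔ χ hχ => h Δ hΔ χ fun Θ hΘ hs => hχ Θ hΘ (hS Θ (List.Subset.trans hΔ hΘ) hs)

theorem of_mem (h : ∀ Δ, Γ ⊆ Δ → S Δ) : Cover T Γ S :=
  fun Δ hΔ _ hχ => hχ Δ (List.Subset.refl _) (h Δ hΔ)

/-- Together with `imp` and `of_mem`, this makes `Cover` a closure operator. -/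
theorem join (h : Cover T Γ fun Δ => Cover T Δ S) : Cover T Γ S :=
  fun Δ hΔ χ hχ => h Δ hΔ χ fun Θ hΘ hs =>
    hs Θ (List.Subset.refl _) χ fun Ξ hΞ => hχ Ξ (List.Subset.trans hΘ hΞ)

theorem proves {χ : SetFormula} (h : Cover T Γ fun Δ => Proves T Δ χ) : Proves T Γ χ :=
  h Γ (List.Subset.refl _) χ fun _ _ h => h

end Cover

namespace ClassFormula

variable {T : Set SetFormula}

/-- `Forces T s E Γ φ`: the context `Γ` forces `φ` under the assignments `s` of sets and `E` of
classes to the variables. -/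
def Forces (T : Set SetFormula) :
    (ℕ → ℕ) → (ℕ → SetFormula) → List SetFormula → ClassFormula → Prop
  | _, _, Γ, bot => SetFormula.Proves T Γ .bot
  | s, _, Γ, eq x y => SetFormula.Proves T Γ (.eq (s x) (s y))
  | s, _, Γ, mem x y => SetFormula.Proves T Γ (.mem (s x) (s y))
  | _, E, Γ, eqC X Y => SetFormula.Proves T Γ (.all (.iff (E X) (E Y)))
  | s, E, Γ, memC x X => SetFormula.Proves T Γ ((E X).rename (inst (s x)))
  | s, E, Γ, and φ ψ => Forces T s E Γ φ ∧ Forces T s E Γ ψ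
  | s, E, Γ, or φ ψ => Cover T Γ fun Δ => Forces T s E Δ φ ∨ Forces T s E Δ ψ
  | s, E, Γ, imp φ ψ => ∀ Δ, Γ ⊆ Δ → Forces T s E Δ φ → Forces T s E Δ ψ
  | s, E, Γ, all0 φ => ∀ t, Forces T (push t s) E Γ φ
  | s, E, Γ, ex0 φ => Cover T Γ fun Δ => ∃ t, Forces T (push t s) E Δ φ
  | s, E, Γ, all1 φ => ∀ A, Forces T s (push A E) Γ φ
  | s, E, Γ, ex1 φ => Cover T Γ fun Δ => ∃ A, Forces T s (push A E) Δ φ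

theorem Forces.mono {s : ℕ → ℕ} {E : ℕ → SetFormula} {Γ Δ : List SetFormula} {φ : ClassFormula}
    (h : Forces T s E Γ φ) (hΓ : Γ ⊆ Δ) : Forces T s E Δ φ := by
  induction φ generalizing s E with
  | bot | eq | mem | eqC | memC => exact SetFormula.Proves.weaken h hΓ
  | and φ ψ ihφ ihψ => exact ⟨ihφ h.1, ihψ h.2⟩
  | imp φ ψ ihφ ihψ => exact fun Θ hΘ => h Θ (List.Subset.trans hΓ hΘ)
  | all0 φ ih => exact fun t => ih (h t)
  | all1 φ ih => exact fun A => ih (h A)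
  | or | ex0 | ex1 => exact Cover.mono h hΓ

/-- Atomic formulas are forced by provability, to which a cover applies with the formula itself as
target; the clauses for `∨` and `∃` are already covers. Eliminating `∨`, `∃` and `⊥` into an
arbitrary formula depends on this. -/
theorem Forces.of_cover {s : ℕ → ℕ} {E : ℕ → SetFormula} {Γ : List SetFormula}
    {φ : ClassFormula} (h : Cover T Γ fun Δ => Forces T s E Δ φ) : Forces T s E Γ φ := by
  induction φ generalizing s E Γ with
  | bot | eq | mem | eqC | memC => exact Cover.proves h
  | and φ ψ ihφ ihψ =>
    exact ⟨ihφ (h.imp fun _ _ h => h.1), ihψ (h.imp fun _ _ h => h.2)⟩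
  | imp φ ψ ihφ ihψ =>
    exact fun Δ hΔ hφ => ihψ ((h.mono hΔ).imp fun Θ hΘ h =>
      h Θ (List.Subset.refl _) (hφ.mono hΘ))
  | all0 φ ih => exact fun t => ih (h.imp fun _ _ h => h t)
  | all1 φ ih => exact fun A => ih (h.imp fun _ _ h => h A)
  | or | ex0 | ex1 => exact Cover.join h

theorem forces_rename (s : ℕ → ℕ) (E : ℕ → SetFormula) (Γ : List SetFormula) (ρ σ : ℕ → ℕ)
    (φ : ClassFormula) : Forces T s E Γ (φ.rename ρ σ) ↔ Forces T (s ∘ ρ) (E ∘ σ) Γ φ := by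
  induction φ generalizing s E Γ ρ σ with
  | bot | eq | mem | eqC | memC => rfl
  | and φ ψ ihφ ihψ => simp only [rename, Forces, ihφ, ihψ]
  | or φ ψ ihφ ihψ => simp only [rename, Forces, ihφ, ihψ]
  | imp φ ψ ihφ ihψ => simp only [rename, Forces, ihφ, ihψ]
  | all0 φ ih => simp only [rename, Forces, ih, push_comp_up]
  | all1 φ ih => simp only [rename, Forces, ih, push_comp_up]
  | ex0 φ ih => simp only [rename, Forces, ih, push_comp_up]
  | ex1 φ ih => simp only [rename, Forces, ih, push_comp_up]

/-- Replacement of provably equal sets and classes. -/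
theorem Forces.congr {s s' : ℕ → ℕ} {E E' : ℕ → SetFormula} {Γ : List SetFormula}
    {φ : ClassFormula} (hs : ∀ i, SetFormula.Proves T Γ (.eq (s i) (s' i)))
    (hE : ∀ X t, SetFormula.Proves T Γ (((E X).iff (E' X)).rename (inst t))) (hT : RenameClosed T) :
    Forces T s E Γ φ ↔ Forces T s' E' Γ φ := by
  -- The hypotheses are symmetric, so one direction suffices. It is stated for arbitrary assignments
  -- because the implication case uses it backwards on the antecedent.
  suffices H : ∀ {s s' : ℕ → ℕ} {E E' : ℕ → SetFormula} {Γ : List SetFormula},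
      (∀ i, SetFormula.Proves T Γ (.eq (s i) (s' i))) →
      (∀ X t, SetFormula.Proves T Γ (((E X).iff (E' X)).rename (inst t))) →
      Forces T s E Γ φ → Forces T s' E' Γ φ from
    ⟨H hs hE, H (fun i => (hs i).eq_symm) fun X t => .andI (.andE₂ (hE X t)) (.andE₁ (hE X t))⟩
  clear hs hE
  have symmE : ∀ {E E' : ℕ → SetFormula} {Γ : List SetFormula},
      (∀ X t, SetFormula.Proves T Γ (((E X).iff (E' X)).rename (inst t))) →
      ∀ X t, SetFormula.Proves T Γ (((E' X).iff (E X)).rename (inst t)) :=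
    fun h X t => .andI (.andE₂ (h X t)) (.andE₁ (h X t))
  have pushs : ∀ {s s' : ℕ → ℕ} {Γ : List SetFormula} (t : ℕ),
      (∀ i, SetFormula.Proves T Γ (.eq (s i) (s' i))) →
      ∀ i, SetFormula.Proves T Γ (.eq (push t s i) (push t s' i)) := by
    intro s s' Γ t h i
    cases i with
    | zero => exact .eqI t
    | succ i => exact h i
  have pushE : ∀ {E E' : ℕ → SetFormula} {Γ : List SetFormula} (A : SetFormula),
      (∀ X t, SetFormula.Proves T Γ (((E X).iff (E' X)).rename (inst t))) →
      ∀ X t, SetFormula.Proves T Γ (((push A E X).iff (push A E' X)).rename (inst t)) := by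
    intro E E' Γ A h X t
    cases X with
    | zero => exact .iff_intro (.hyp List.mem_cons_self) (.hyp List.mem_cons_self)
    | succ X => exact h X t
  induction φ with
  | bot => exact fun _ _ h => h
  | eq x y => exact fun hs _ h => .eq_congr (hs x) (hs y) h
  | mem x y => exact fun hs _ h => .mem_congr (hs x) (hs y) h
  | eqC X Y =>
    intro s s' E E' Γ _ hE h
    refine .all_of_forall hT fun t => ?_
    have h₁ := fun (Δ) (hΔ : Γ ⊆ Δ) => (hE X t).weaken hΔ
    have h₂ := fun (Δ) (hΔ : Γ ⊆ Δ) => (hE Y t).weaken hΔ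
    have h₃ := fun (Δ) (hΔ : Γ ⊆ Δ) => (SetFormula.Proves.allE t h).weaken hΔ
    refine .iff_intro ?_ ?_
    · exact .iff_mp (h₂ _ (List.subset_cons_self _ _)) (.iff_mp (h₃ _ (List.subset_cons_self _ _))
        (.iff_mpr (h₁ _ (List.subset_cons_self _ _)) (.hyp List.mem_cons_self)))
    · exact .iff_mp (h₁ _ (List.subset_cons_self _ _)) (.iff_mpr (h₃ _ (List.subset_cons_self _ _))
        (.iff_mpr (h₂ _ (List.subset_cons_self _ _)) (.hyp List.mem_cons_self)))
  | memC x X => exact fun hs hE h => .iff_mp (hE X _) (.eqE (hs x) h)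
  | and φ ψ ihφ ihψ => exact fun hs hE h => ⟨ihφ hs hE h.1, ihψ hs hE h.2⟩
  | or φ ψ ihφ ihψ =>
    exact fun hs hE h => Cover.imp h fun Δ hΔ h => h.imp
      (ihφ (fun i => (hs i).weaken hΔ) fun X t => (hE X t).weaken hΔ)
      (ihψ (fun i => (hs i).weaken hΔ) fun X t => (hE X t).weaken hΔ)
  | imp φ ψ ihφ ihψ =>
    exact fun hs hE h Δ hΔ hφ =>
      ihψ (fun i => (hs i).weaken hΔ) (fun X t => (hE X t).weaken hΔ) (h Δ hΔ
        (ihφ (fun i => (hs i).eq_symm.weaken hΔ) (fun X t => (symmE hE X t).weaken hΔ) hφ))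
  | all0 φ ih => exact fun hs hE h t => ih (pushs t hs) hE (h t)
  | ex0 φ ih =>
    exact fun hs hE h => Cover.imp h fun Δ hΔ ⟨t, h⟩ =>
      ⟨t, ih (pushs t fun i => (hs i).weaken hΔ) (fun X t => (hE X t).weaken hΔ) h⟩
  | all1 φ ih => exact fun hs hE h A => ih hs (pushE A hE) (h A)
  | ex1 φ ih =>
    exact fun hs hE h => Cover.imp h fun Δ hΔ ⟨A, h⟩ =>
      ⟨A, ih (fun i => (hs i).weaken hΔ) (pushE A fun X t => (hE X t).weaken hΔ) h⟩

/-! ### Soundness of forcing. -/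

/-- Forcing is sound for two-sorted intuitionistic logic. -/
theorem Proves.forces (hT : RenameClosed T) {S : Set ClassFormula}
    (hS : ∀ φ ∈ S, ∀ s E Γ, Forces T s E Γ φ) {Φ : List ClassFormula} {φ : ClassFormula}
    (h : Proves S Φ φ) (s : ℕ → ℕ) (E : ℕ → SetFormula) (Γ : List SetFormula)
    (hΦ : ∀ ψ ∈ Φ, Forces T s E Γ ψ) : Forces T s E Γ φ := by
  have cons : ∀ {Φ : List ClassFormula} {ψ : ClassFormula} {s E} {Γ Δ : List SetFormula},
      (∀ χ ∈ Φ, Forces T s E Γ χ) → Γ ⊆ Δ → Forces T s E Δ ψ →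
      ∀ χ ∈ ψ :: Φ, Forces T s E Δ χ := by
    intro Φ ψ s E Γ Δ h hΔ hψ χ hχ
    rcases List.mem_cons.1 hχ with rfl | hχ
    · exact hψ
    · exact (h χ hχ).mono hΔ
  have shift0 : ∀ {Φ : List ClassFormula} {s E Γ} (t : ℕ), (∀ χ ∈ Φ, Forces T s E Γ χ) →
      ∀ χ ∈ Φ.map (rename Nat.succ id), Forces T (push t s) E Γ χ := by
    intro Φ s E Γ t h χ hχ
    obtain ⟨χ, hχ', rfl⟩ := List.mem_map.1 hχ
    exact (forces_rename ..).2 (h χ hχ')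
  have shift1 : ∀ {Φ : List ClassFormula} {s E Γ} (A : SetFormula),
      (∀ χ ∈ Φ, Forces T s E Γ χ) →
      ∀ χ ∈ Φ.map (rename id Nat.succ), Forces T s (push A E) Γ χ := by
    intro Φ s E Γ t h χ hχ
    obtain ⟨χ, hχ', rfl⟩ := List.mem_map.1 hχ
    exact (forces_rename ..).2 (h χ hχ')
  induction h generalizing s E Γ with
  | ax h => exact hS _ h s E Γ
  | hyp h => exact hΦ _ h
  | botE _ ih =>
    -- An inconsistent context proves every target, so any family covers it.
    exact .of_cover fun Δ hΔ χ _ => .botE (SetFormula.Proves.weaken (ih s E Γ hΦ) hΔ)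
  | andI _ _ ih₁ ih₂ => exact ⟨ih₁ s E Γ hΦ, ih₂ s E Γ hΦ⟩
  | andE₁ _ ih => exact (ih s E Γ hΦ).1
  | andE₂ _ ih => exact (ih s E Γ hΦ).2
  | orI₁ _ ih => exact Cover.of_mem fun Δ hΔ => .inl ((ih s E Γ hΦ).mono hΔ)
  | orI₂ _ ih => exact Cover.of_mem fun Δ hΔ => .inr ((ih s E Γ hΦ).mono hΔ)
  | orE _ _ _ ih ih₁ ih₂ =>
    exact .of_cover (Cover.imp (ih s E Γ hΦ) fun Δ hΔ h =>
      h.elim (fun h => ih₁ s E Δ (cons hΦ hΔ h)) fun h => ih₂ s E Δ (cons hΦ hΔ h))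
  | impI _ ih => exact fun Δ hΔ h => ih s E Δ (cons hΦ hΔ h)
  | impE _ _ ih₁ ih₂ => exact ih₁ s E Γ hΦ Γ (List.Subset.refl _) (ih₂ s E Γ hΦ)
  | all0I _ ih => exact fun t => ih _ E Γ (shift0 t hΦ)
  | all0E t _ ih =>
    rw [forces_rename, comp_inst]
    exact ih s E Γ hΦ _
  | ex0I t _ ih =>
    have := ih s E Γ hΦ
    rw [forces_rename, comp_inst] at this
    exact Cover.of_mem fun Δ hΔ => ⟨_, this.mono hΔ⟩
  | ex0E _ _ ih₁ ih₂ =>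
    refine .of_cover (Cover.imp (ih₁ s E Γ hΦ) fun Δ hΔ ⟨t, h⟩ => ?_)
    exact (forces_rename (push t s) E Δ Nat.succ id _).1
      (ih₂ (push t s) E Δ (cons (shift0 t hΦ) hΔ h))
  | all1I _ ih => exact fun A => ih s _ Γ (shift1 A hΦ)
  | all1E t _ ih =>
    rw [forces_rename, comp_inst]
    exact ih s E Γ hΦ _
  | ex1I t _ ih =>
    have := ih s E Γ hΦ
    rw [forces_rename, comp_inst] at this
    exact Cover.of_mem fun Δ hΔ => ⟨_, this.mono hΔ⟩
  | ex1E _ _ ih₁ ih₂ =>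
    refine .of_cover (Cover.imp (ih₁ s E Γ hΦ) fun Δ hΔ ⟨A, h⟩ => ?_)
    exact (forces_rename s (push A E) Δ id Nat.succ _).1
      (ih₂ s (push A E) Δ (cons (shift1 A hΦ) hΔ h))
  | eqI t => exact .eqI _
  | eqE _ _ ih₁ ih₂ =>
    have := ih₂ s E Γ hΦ
    rw [forces_rename, comp_inst] at this ⊢
    -- The two assignments differ only at the variable `0`, where their values are provably equal.
    refine (Forces.congr (fun i => ?_) (fun X t => ?_) hT).1 this
    · cases i with
      | zero => exact ih₁ s E Γ hΦ
      | succ i => exact .eqI _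
    · exact .iff_intro (.hyp List.mem_cons_self) (.hyp List.mem_cons_self)
  | eqCI t =>
    exact SetFormula.Proves.all_of_forall hT fun _ =>
      .iff_intro (.hyp List.mem_cons_self) (.hyp List.mem_cons_self)
  | eqCE _ _ ih₁ ih₂ =>
    have := ih₂ s E Γ hΦ
    rw [forces_rename, comp_inst] at this ⊢
    refine (Forces.congr (fun i => .eqI _) (fun X t => ?_) hT).1 this
    cases X with
    | zero => exact .allE t (ih₁ s E Γ hΦ)
    | succ i => exact .iff_intro (.hyp List.mem_cons_self) (.hyp List.mem_cons_self)

/-! ### Elementary formulas, Comprehension and Class Extensionality. -/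

/-- The first-order formula obtained from an elementary formula by renaming its set variables by
`s` and replacing its class variables by the definable classes `E`. -/
def replaceClasses : (ℕ → ℕ) → (ℕ → SetFormula) → ClassFormula → SetFormula
  | _, _, bot => .bot
  | s, _, eq x y => .eq (s x) (s y)
  | s, _, mem x y => .mem (s x) (s y)
  | _, E, eqC X Y => .all (.iff (E X) (E Y))
  | s, E, memC x X => (E X).rename (inst (s x))
  | s, E, and φ ψ => .and (φ.replaceClasses s E) (ψ.replaceClasses s E)
  | s, E, or φ ψ => .or (φ.replaceClasses s E) (ψ.replaceClasses s E)
  | s, E, imp φ ψ => .imp (φ.replaceClasses s E) (ψ.replaceClasses s E)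
  -- Variable `0` of a class is its element, so passing a set quantifier shifts only the parameters.
  | s, E, all0 φ => .all (φ.replaceClasses (up s) fun X => (E X).rename (up Nat.succ))
  | s, E, ex0 φ => .ex (φ.replaceClasses (up s) fun X => (E X).rename (up Nat.succ))
  -- Junk values: the translation is meaningful only for elementary formulas.
  | _, _, all1 _ => .bot
  | _, _, ex1 _ => .bot

theorem rename_replaceClasses (s : ℕ → ℕ) (E : ℕ → SetFormula) (φ : ClassFormula) (ρ : ℕ → ℕ) :
    (φ.replaceClasses s E).rename ρ =
      φ.replaceClasses (ρ ∘ s) fun X => (E X).rename (up ρ) := by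
  induction φ generalizing s E ρ with
  | bot | eq | mem | eqC | all1 | ex1 => rfl
  | memC x X => exact SetFormula.Proves.rename_inst ..
  | and φ ψ ihφ ihψ | or φ ψ ihφ ihψ | imp φ ψ ihφ ihψ =>
    simp only [replaceClasses, SetFormula.rename, ihφ, ihψ]
  | all0 φ ih | ex0 φ ih =>
    simp only [replaceClasses, SetFormula.rename, ih, up_comp, SetFormula.rename_rename,
      up_comp_succ]

/-- Instantiation cancels the shift of the class parameters, leaving exactly the assignment in the
forcing clauses for set quantifiers. -/
theorem rename_inst_replaceClasses (s : ℕ → ℕ) (E : ℕ → SetFormula) (φ : ClassFormula) (t : ℕ) :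
    (φ.replaceClasses (up s) fun X => (E X).rename (up Nat.succ)).rename (inst t) =
      φ.replaceClasses (push t s) E := by
  simp only [rename_replaceClasses, inst_comp_up, SetFormula.rename_rename, up_comp,
    inst_comp_succ, up_id, SetFormula.rename_id]

theorem replaceClasses_toClass (s : ℕ → ℕ) (E : ℕ → SetFormula) (φ : SetFormula) :
    φ.toClass.replaceClasses s E = φ.rename s := by
  induction φ generalizing s E <;>
    simp_all [SetFormula.toClass, replaceClasses, SetFormula.rename]

/-- Forcing of elementary formulas is provability. -/
theorem forces_iff_proves (hT : RenameClosed T) {φ : ClassFormula} (hφ : φ.IsElementary)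
    (s : ℕ → ℕ) (E : ℕ → SetFormula) (Γ : List SetFormula) :
    Forces T s E Γ φ ↔ SetFormula.Proves T Γ (φ.replaceClasses s E) := by
  induction φ generalizing s E Γ with
  | bot | eq | mem | eqC | memC => rfl
  | and φ ψ ihφ ihψ =>
    simp only [Forces, ihφ hφ.1, ihψ hφ.2]
    exact ⟨fun h => .andI h.1 h.2, fun h => ⟨.andE₁ h, .andE₂ h⟩⟩
  | or φ ψ ihφ ihψ =>
    simp only [Forces, ihφ hφ.1, ihψ hφ.2]
    refine ⟨fun h => (h.imp fun _ _ h => h.elim .orI₁ .orI₂).proves, fun h Δ hΔ χ hχ => ?_⟩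
    -- The two contexts that add one disjunct form the cover; since `Cover` allows any target `χ`,
    -- this is just disjunction elimination.
    refine .orE (h.weaken hΔ) ?_ ?_
    · exact hχ _ (List.subset_cons_self _ _) (.inl (.hyp List.mem_cons_self))
    · exact hχ _ (List.subset_cons_self _ _) (.inr (.hyp List.mem_cons_self))
  | imp φ ψ ihφ ihψ =>
    simp only [Forces, ihφ hφ.1, ihψ hφ.2]
    exact ⟨fun h => .impI (h _ (List.subset_cons_self _ _) (.hyp List.mem_cons_self)),
      fun h Δ hΔ h' => .impE (h.weaken hΔ) h'⟩
  | all0 φ ih =>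
    simp only [Forces, ih hφ]
    refine ⟨fun h => .all_of_forall hT fun t => ?_, fun h t => ?_⟩
    · rw [rename_inst_replaceClasses]
      exact h t
    · rw [← rename_inst_replaceClasses]
      exact .allE t h
  | ex0 φ ih =>
    simp only [Forces, ih hφ]
    refine ⟨fun h => Cover.proves (h.imp ?_), fun h Δ hΔ χ hχ => ?_⟩
    · rintro Δ - ⟨t, h⟩
      refine .exI t ?_
      rw [rename_inst_replaceClasses]
      exact h
    · refine .ex_elim hT (h.weaken hΔ) fun t => ?_
      refine hχ _ (List.subset_cons_self _ _) ⟨t, ?_⟩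
      rw [← rename_inst_replaceClasses]
      exact .hyp List.mem_cons_self
  | all1 | ex1 => exact hφ.elim

theorem isElementary_toClass (φ : SetFormula) : φ.toClass.IsElementary := by
  induction φ <;> simp_all [SetFormula.toClass, IsElementary]

theorem forces_toClass (hT : RenameClosed T) (φ : SetFormula) (s : ℕ → ℕ) (E : ℕ → SetFormula)
    (Γ : List SetFormula) : Forces T s E Γ φ.toClass ↔ SetFormula.Proves T Γ (φ.rename s) := by
  rw [forces_iff_proves hT (isElementary_toClass φ), replaceClasses_toClass]

/-- Elementary Comprehension is forced: its witness is a definable class. -/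
theorem forces_comprehension (hT : RenameClosed T) {φ : ClassFormula} (hφ : φ.IsElementary)
    (s : ℕ → ℕ) (E : ℕ → SetFormula) (Γ : List SetFormula) :
    Forces T s E Γ (comprehension φ) := by
  refine Cover.of_mem fun Δ _ =>
    -- The witness is the translation of `φ` itself, with variable `0` kept free for the element.
    ⟨φ.replaceClasses (up s) fun X => (E X).rename (up Nat.succ), fun t => ?_⟩
  have key : ∀ Θ, Forces T (push t s) (push (φ.replaceClasses (up s)
        fun X => (E X).rename (up Nat.succ)) E) Θ (memC 0 0) ↔
      Forces T (push t s) (push (φ.replaceClasses (up s)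
        fun X => (E X).rename (up Nat.succ)) E) Θ (φ.rename id Nat.succ) := by
    intro Θ
    rw [forces_rename, push_comp_succ, Function.comp_id, forces_iff_proves hT hφ,
      ← rename_inst_replaceClasses]
    rfl
  exact ⟨fun Θ _ => (key Θ).1, fun Θ _ => (key Θ).2⟩

/-- Class equality is interpreted as provable coextensionality, so both sides of the axiom have the
same translation. -/
theorem forces_classExtensionality (hT : RenameClosed T) (s : ℕ → ℕ) (E : ℕ → SetFormula)
    (Γ : List SetFormula) : Forces T s E Γ classExtensionality := by
  intro A B
  have key : ∀ Θ, Forces T s (push B (push A E)) Θ (eqC 1 0) ↔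
      Forces T s (push B (push A E)) Θ (all0 (iff (memC 0 1) (memC 0 0))) := by
    intro Θ
    rw [forces_iff_proves hT (by simp [IsElementary]),
      forces_iff_proves hT (by simp [iff, IsElementary])]
    have h : inst 0 ∘ up Nat.succ = id := by
      funext n; cases n <;> rfl
    simp only [iff, replaceClasses, push, SetFormula.rename_rename, up_zero, h,
      SetFormula.rename_id, SetFormula.iff]
  exact ⟨fun Θ _ => (key Θ).1, fun Θ _ => (key Θ).2⟩

end ClassFormula

/-! ### The theories are closed under renaming -/

/-- These rules bring compositions with `vars` into a normal form built from `push`, so that `simp`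
can compare scheme instances. -/
theorem comp_vars_cons {α : Type*} (f : ℕ → α) (i : ℕ) (l : List ℕ) (k : ℕ) :
    f ∘ vars (i :: l) k = push (f i) (f ∘ vars l k) := by
  funext n; cases n <;> simp [vars]

theorem comp_vars_nil {α : Type*} (f : ℕ → α) (k : ℕ) : f ∘ vars [] k = fun i => f (i + k) := by
  funext n; simp [vars]

theorem vars_cons_comp_up (i : ℕ) (l : List ℕ) (k : ℕ) (ρ : ℕ → ℕ) :
    vars (i :: l) k ∘ up ρ = push i (vars l k ∘ ρ) := by
  funext n; cases n <;> simp [vars]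

theorem vars_nil_comp (k : ℕ) (ρ : ℕ → ℕ) : vars [] k ∘ ρ = fun i => ρ i + k := by
  funext n; simp [vars]

namespace SetFormula

theorem IsBounded.rename {φ : SetFormula} (h : IsBounded φ) (ρ : ℕ → ℕ) :
    IsBounded (φ.rename ρ) := by
  induction h generalizing ρ with
  | bot => exact .bot
  | eq => exact .eq _ _
  | mem => exact .mem _ _
  | and _ _ ih₁ ih₂ => exact .and (ih₁ ρ) (ih₂ ρ)
  | or _ _ ih₁ ih₂ => exact .or (ih₁ ρ) (ih₂ ρ)
  | imp _ _ ih₁ ih₂ => exact .imp (ih₁ ρ) (ih₂ ρ)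
  | allIn a _ ih => exact .allIn (ρ a) (ih (up ρ))
  | exIn a _ ih => exact .exIn (ρ a) (ih (up ρ))

/-- A renaming acts only on the parameters of an instance, so it is lifted once for each displayed
argument of `φ`; likewise for the other schemes. -/
theorem rename_setInduction (φ : SetFormula) (ρ : ℕ → ℕ) :
    (setInduction φ).rename ρ = setInduction (φ.rename (up ρ)) := by
  simp [setInduction, allIn, rename, rename_rename, comp_vars_cons, comp_vars_nil,
    vars_cons_comp_up, vars_nil_comp]

theorem rename_separation (φ : SetFormula) (ρ : ℕ → ℕ) :
    (separation φ).rename ρ = separation (φ.rename (up ρ)) := by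
  simp [separation, iff, rename, rename_rename, comp_vars_cons, comp_vars_nil,
    vars_cons_comp_up, vars_nil_comp, up]

theorem rename_collection (φ : SetFormula) (ρ : ℕ → ℕ) :
    (collection φ).rename ρ = collection (φ.rename (up (up ρ))) := by
  simp [collection, allIn, exIn, rename, rename_rename, comp_vars_cons, comp_vars_nil,
    vars_cons_comp_up, vars_nil_comp, up]

theorem rename_strongCollection (φ : SetFormula) (ρ : ℕ → ℕ) :
    (strongCollection φ).rename ρ = strongCollection (φ.rename (up (up ρ))) := by
  simp [strongCollection, allIn, exIn, rename, rename_rename, comp_vars_cons, comp_vars_nil,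
    vars_cons_comp_up, vars_nil_comp, up]

theorem rename_subsetCollection (φ : SetFormula) (ρ : ℕ → ℕ) :
    (subsetCollection φ).rename ρ = subsetCollection (φ.rename (up (up (up ρ)))) := by
  simp [subsetCollection, allIn, exIn, rename, rename_rename, comp_vars_cons, comp_vars_nil,
    vars_cons_comp_up, vars_nil_comp, up]

end SetFormula

open SetFormula

theorem renameClosed_IZF : RenameClosed IZF := by
  rintro ψ (((h | ⟨φ, rfl⟩) | ⟨φ, rfl⟩) | ⟨φ, rfl⟩) ρ
  · refine .inl (.inl (.inl ?_))
    -- The single axioms are closed formulas, fixed definitionally by every renaming.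
    rcases h with rfl | rfl | rfl | rfl | rfl
    · exact .inl rfl
    · exact .inr (.inl rfl)
    · exact .inr (.inr (.inl rfl))
    · exact .inr (.inr (.inr (.inl rfl)))
    · exact .inr (.inr (.inr (.inr rfl)))
  · exact .inl (.inl (.inr ⟨_, rename_setInduction φ ρ⟩))
  · exact .inl (.inr ⟨_, rename_separation φ ρ⟩)
  · exact .inr ⟨_, rename_collection φ ρ⟩

theorem renameClosed_CZF : RenameClosed CZF := by
  rintro ψ ((((h | ⟨φ, rfl⟩) | ⟨φ, hφ, rfl⟩) | ⟨φ, rfl⟩) | ⟨φ, rfl⟩) ρ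
  · refine .inl (.inl (.inl (.inl ?_)))
    rcases h with rfl | rfl | rfl | rfl
    · exact .inl rfl
    · exact .inr (.inl rfl)
    · exact .inr (.inr (.inl rfl))
    · exact .inr (.inr (.inr rfl))
  · exact .inl (.inl (.inl (.inr ⟨_, rename_setInduction φ ρ⟩)))
  · exact .inl (.inl (.inr ⟨_, hφ.rename _, rename_separation φ ρ⟩))
  · exact .inl (.inr ⟨_, rename_strongCollection φ ρ⟩)
  · exact .inr ⟨_, rename_subsetCollection φ ρ⟩

/-! ### Inclusion of the one-sorted calculus in the two-sorted one. -/

namespace SetFormula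

theorem toClass_rename (φ : SetFormula) (ρ : ℕ → ℕ) :
    (φ.rename ρ).toClass = φ.toClass.rename ρ id := by
  induction φ generalizing ρ <;> simp_all [rename, toClass, ClassFormula.rename]

/-- The two-sorted calculus extends the one-sorted one. -/
theorem Proves.toClass {T : Set SetFormula} {S : Set ClassFormula}
    (hS : ∀ φ ∈ T, φ.toClass ∈ S) {Γ : List SetFormula} {φ : SetFormula} (h : Proves T Γ φ) :
    ClassFormula.Proves S (Γ.map SetFormula.toClass) φ.toClass := by
  have shift : ∀ Γ : List SetFormula, (Γ.map (SetFormula.rename Nat.succ)).map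
      SetFormula.toClass = (Γ.map SetFormula.toClass).map (ClassFormula.rename Nat.succ id) := by
    intro Γ
    simp [toClass_rename]
  induction h with
  | ax h => exact .ax (hS _ h)
  | hyp h => exact .hyp (List.mem_map_of_mem h)
  | botE _ ih => exact .botE ih
  | andI _ _ ih₁ ih₂ => exact .andI ih₁ ih₂
  | andE₁ _ ih => exact .andE₁ ih
  | andE₂ _ ih => exact .andE₂ ih
  | orI₁ _ ih => exact .orI₁ ih
  | orI₂ _ ih => exact .orI₂ ih
  | orE _ _ _ ih ih₁ ih₂ => exact .orE ih ih₁ ih₂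
  | impI _ ih => exact .impI ih
  | impE _ _ ih₁ ih₂ => exact .impE ih₁ ih₂
  | allI _ ih =>
    rw [shift] at ih
    exact .all0I ih
  | allE t _ ih =>
    rw [toClass_rename]
    exact .all0E t ih
  | exI t _ ih =>
    rw [toClass_rename] at ih
    exact .ex0I t ih
  | exE _ _ ih₁ ih₂ =>
    rw [List.map_cons, shift, toClass_rename] at ih₂
    exact .ex0E ih₁ ih₂
  | eqI t => exact .eqI t
  | eqE _ _ ih₁ ih₂ =>
    rw [toClass_rename] at ih₂ ⊢
    exact .eqE ih₁ ih₂

end SetFormula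

/-! ### Forcing the set and class axioms. -/

namespace ClassFormula

variable {T : Set SetFormula}

theorem forces_of_mem (hT : RenameClosed T) {φ : SetFormula} (hφ : φ ∈ T) (s : ℕ → ℕ)
    (E : ℕ → SetFormula) (Γ : List SetFormula) : Forces T s E Γ φ.toClass :=
  (forces_toClass hT φ s E Γ).2 (.ax (hT φ hφ s))

/-- At a definable class `A`, the translated axiom is literally the induction instance for `A`. -/
theorem forces_classSetInduction (hT : RenameClosed T) (hI : ∀ φ, setInduction φ ∈ T)
    (s : ℕ → ℕ) (E : ℕ → SetFormula) (Γ : List SetFormula) :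
    Forces T s E Γ classSetInduction := by
  intro A
  rw [forces_iff_proves hT (by simp [allIn, IsElementary])]
  convert SetFormula.Proves.ax (hI A) using 1
  have h₁ : inst 0 ∘ up Nat.succ = vars [0] 1 := by
    funext n; cases n <;> simp [vars]
  have h₂ : inst 0 ∘ up Nat.succ ∘ up Nat.succ = vars [0] 2 := by
    funext n; cases n <;> simp [vars]
  simp only [allIn, replaceClasses, setInduction, SetFormula.allIn, SetFormula.rename_rename,
    push_zero, up_zero, up_succ, h₁, h₂]

theorem rename_isOPair (p x y : ℕ) (ρ : ℕ → ℕ) :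
    (isOPair p x y).rename ρ = isOPair (ρ p) (ρ x) (ρ y) := rfl

/-- `⟨x, y⟩ ∈ A` for a definable class `A`, where `x` and `y` are the variables `0` and `1` and the
set `i` is the variable `i + 2`. -/
def pairMemDef (A : SetFormula) : SetFormula :=
  .ex (.and (isOPair 0 1 2) (A.rename (vars [0] 3)))

/-- On the left is the renaming that the translation leaves on a class under four set quantifiers
(`a`, `x`, `y` and the pair), on the right the one produced by the scheme for `pairMemDef`. The
class does not mention `x` and `y`, so their values are arbitrary. The version with five adds the
quantifier over `b`. -/
theorem inst_comp_up_succ_four (x y : ℕ) :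
    inst 0 ∘ up Nat.succ ∘ up Nat.succ ∘ up Nat.succ ∘ up Nat.succ =
      up (vars [x, y] 3) ∘ vars [0] 3 := by
  funext n; cases n <;> simp [vars]

theorem inst_comp_up_succ_five (x y : ℕ) :
    inst 0 ∘ up Nat.succ ∘ up Nat.succ ∘ up Nat.succ ∘ up Nat.succ ∘ up Nat.succ =
      up (vars [x, y] 4) ∘ vars [0] 3 := by
  funext n; cases n <;> simp [vars]

theorem forces_classCollection (hT : RenameClosed T) (hC : ∀ φ, collection φ ∈ T)
    (s : ℕ → ℕ) (E : ℕ → SetFormula) (Γ : List SetFormula) :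
    Forces T s E Γ classCollection := by
  intro A
  rw [forces_iff_proves hT (by simp [allIn, exIn, pairMemC, IsElementary, isElementary_toClass])]
  convert SetFormula.Proves.ax (hC (pairMemDef A)) using 1
  simp only [allIn, exIn, replaceClasses, pairMemC, pairMemDef, collection, SetFormula.allIn,
    SetFormula.exIn, SetFormula.rename_rename, replaceClasses_toClass, SetFormula.rename,
    rename_isOPair, push_zero, up_zero, inst_comp_up_succ_four 1 0, inst_comp_up_succ_five 1 0]
  rfl

theorem forces_classStrongCollection (hT : RenameClosed T) (hC : ∀ φ, strongCollection φ ∈ T)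
    (s : ℕ → ℕ) (E : ℕ → SetFormula) (Γ : List SetFormula) :
    Forces T s E Γ classStrongCollection := by
  intro A
  rw [forces_iff_proves hT (by simp [allIn, exIn, pairMemC, IsElementary, isElementary_toClass])]
  convert SetFormula.Proves.ax (hC (pairMemDef A)) using 1
  -- Both orders of `x` and `y` occur here; rewriting from right to left removes the dependence on
  -- the order.
  simp only [allIn, exIn, replaceClasses, pairMemC, pairMemDef, strongCollection,
    SetFormula.allIn, SetFormula.exIn, SetFormula.rename_rename, replaceClasses_toClass,
    SetFormula.rename, rename_isOPair, push_zero, up_zero, ← inst_comp_up_succ_four,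
    ← inst_comp_up_succ_five]
  rfl

theorem forces_classSeparation (hT : RenameClosed T) (hS : ∀ φ, separation φ ∈ T)
    (s : ℕ → ℕ) (E : ℕ → SetFormula) (Γ : List SetFormula) :
    Forces T s E Γ classSeparation := by
  intro A a
  -- The parameters of `A` are themselves sets of the forcing, hence the assignment `id` rather than
  -- `s`. The axiom and the scheme order their conjuncts differently, so the forcing clauses are
  -- unfolded.
  refine Cover.imp (forces_of_mem hT (hS A) id E Γ a) fun Δ _ ⟨b, hb⟩ => ⟨b, fun t => ?_⟩
  have hA : ∀ Θ, Forces T (push t (push b (push a id))) E Θ (A.rename (vars [0] 3)).toClass ↔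
      SetFormula.Proves T Θ (A.rename (inst t)) := by
    intro Θ
    rw [forces_toClass hT, SetFormula.rename_rename]
    have : push t (push b (push a id)) ∘ vars [0] 3 = inst t := by
      funext n; cases n <;> rfl
    rw [this]
  refine ⟨fun Θ hΘ h => ?_, fun Θ hΘ h => ?_⟩
  · obtain ⟨h₁, h₂⟩ := (hb t).1 Θ hΘ h
    exact ⟨(hA Θ).1 h₂, h₁⟩
  · exact (hb t).2 Θ hΘ ⟨h.2, (hA Θ).2 h.1⟩

/-- Full Separation and Collection give Strong Collection. -/
theorem forces_strongCollection (hT : RenameClosed T) (hS : ∀ φ, separation φ ∈ T)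
    (hC : ∀ φ, collection φ ∈ T) (φ : SetFormula) (s : ℕ → ℕ) (E : ℕ → SetFormula)
    (Γ : List SetFormula) : Forces T s E Γ (strongCollection φ).toClass := by
  intro a Δ hΔ h
  have hcol := forces_of_mem hT (hC φ) s E Δ a Δ (List.Subset.refl _) h
  refine Forces.of_cover (Cover.imp hcol fun Θ hΘ ⟨b, hb⟩ => ?_)
  -- From the set `b` given by Collection, cut out `c = {y ∈ b | ∃ x ∈ a, φ(x, y)}`; the parameter
  -- `1` is `a`.
  have hsep := forces_of_mem hT (hS (.exIn 1 (φ.rename (vars [0, 1] 3)))) (push a s) E Θ b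
  refine Cover.imp hsep fun Ξ hΞ ⟨c, hc⟩ => ⟨c, ?_⟩
  have hv : vars [0] 3 1 = 3 := rfl
  simp only [SetFormula.allIn, SetFormula.exIn, SetFormula.iff, SetFormula.rename, toClass,
    Forces, toClass_rename, forces_rename, Function.comp_id, comp_vars_cons, comp_vars_nil,
    push_comp_up, push, hv, up] at hb hc ⊢
  refine ⟨fun x Λ hΛ hx => ?_, fun y Λ hΛ hy => ((hc y).1 Λ hΛ hy).2⟩
  refine Cover.imp (hb x Λ (List.Subset.trans hΞ hΛ) hx) fun Ω hΩ ⟨y, hy, hxy⟩ => ?_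
  refine ⟨y, (hc y).2 Ω (List.Subset.trans hΛ hΩ) ⟨hy, ?_⟩, hxy⟩
  exact Cover.of_mem fun Ω' hΩ' =>
    ⟨x, (hx.weaken hΩ).weaken hΩ', hxy.mono hΩ'⟩

/-- Powerset and full Separation give Subset Collection. -/
theorem forces_subsetCollection (hT : RenameClosed T) (hS : ∀ φ, separation φ ∈ T)
    (hP : powerset ∈ T) (φ : SetFormula) (s : ℕ → ℕ) (E : ℕ → SetFormula)
    (Γ : List SetFormula) : Forces T s E Γ (subsetCollection φ).toClass := by
  intro a b
  refine Cover.imp (forces_of_mem hT hP s E Γ b) fun Δ hΔ ⟨c, hc⟩ => ⟨c, fun u Θ hΘ h => ?_⟩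
  -- With `c` the powerset of `b`, take `d = {y ∈ b | ∃ x ∈ a, φ(x, y, u)}`, which lies in `c`; the
  -- parameters `1` and `2` are `a` and `u`.
  have hsep := forces_of_mem hT (hS (.exIn 1 (φ.rename (vars [0, 1, 3] 4)))) (push a (push u s))
    E Θ b
  refine Cover.imp hsep fun Ξ hΞ ⟨d, hd⟩ => ⟨d, ?_⟩
  have hv : vars [0] 3 1 = 3 := rfl
  simp only [SetFormula.allIn, SetFormula.exIn, SetFormula.iff, SetFormula.sub,
    SetFormula.rename, toClass, Forces, toClass_rename, forces_rename, Function.comp_id,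
    comp_vars_cons, comp_vars_nil, push_comp_up, push, hv, up]
    at h hc hd ⊢
  refine ⟨(hc d).2 Ξ (List.Subset.trans hΘ hΞ) fun y Λ hΛ hy => ((hd y).1 Λ hΛ hy).1,
    fun x Λ hΛ hx => ?_, fun y Λ hΛ hy => ((hd y).1 Λ hΛ hy).2⟩
  refine Cover.imp (h x Λ (List.Subset.trans hΞ hΛ) hx) fun Ω hΩ ⟨y, hy, hxy⟩ => ?_
  refine ⟨y, (hd y).2 Ω (List.Subset.trans hΛ hΩ) ⟨hy, ?_⟩, hxy⟩
  exact Cover.of_mem fun Ω' hΩ' =>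
    ⟨x, (hx.weaken hΩ).weaken hΩ', hxy.mono hΩ'⟩

/-- A theory whose axioms are forced over `T` and that contains the axioms of `T` is conservative
over `T`. -/
theorem isConservativeOver_of_forces (hT : RenameClosed T) {S : Set ClassFormula}
    (hTS : ∀ φ ∈ T, φ.toClass ∈ S) (hS : ∀ φ ∈ S, ∀ s E Γ, Forces T s E Γ φ) :
    IsConservativeOver S T := by
  refine fun φ => ⟨fun h => ?_, fun h => h.toClass hTS⟩
  have := h.forces hT hS id (fun _ => .bot) [] (by simp)
  rwa [forces_toClass hT, SetFormula.rename_id] at this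

end ClassFormula

/-! ### Conservativity and proof-theoretic strength. -/

open ClassFormula

theorem isConservativeOver_CGB_CZF : IsConservativeOver CGB CZF := by
  refine isConservativeOver_of_forces renameClosed_CZF
    (fun φ hφ => .inl (.inl ⟨φ, hφ, rfl⟩)) ?_
  rintro ψ ((⟨φ, hφ, rfl⟩ | rfl | rfl | rfl) | ⟨φ, hφ, rfl⟩) s E Γ
  · exact forces_of_mem renameClosed_CZF hφ s E Γ
  · exact forces_classExtensionality renameClosed_CZF s E Γ
  · exact forces_classSetInduction renameClosed_CZF
      (fun φ => .inl (.inl (.inl (.inr ⟨φ, rfl⟩)))) s E Γ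
  · exact forces_classStrongCollection renameClosed_CZF (fun φ => .inl (.inr ⟨φ, rfl⟩)) s E Γ
  · exact forces_comprehension renameClosed_CZF hφ s E Γ

/-- Only Strong Collection and Subset Collection need an argument; every other axiom of `CZF` is an
axiom of `IZF`. -/
theorem forces_IZF_of_mem_CZF {φ : SetFormula} (hφ : φ ∈ CZF) (s : ℕ → ℕ)
    (E : ℕ → SetFormula) (Γ : List SetFormula) : Forces IZF s E Γ φ.toClass := by
  have hS : ∀ φ, separation φ ∈ IZF := fun φ => .inl (.inr ⟨φ, rfl⟩)
  rcases hφ with (((h | ⟨φ, rfl⟩) | ⟨φ, -, rfl⟩) | ⟨φ, rfl⟩) | ⟨φ, rfl⟩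
  · refine forces_of_mem renameClosed_IZF (.inl (.inl (.inl ?_))) s E Γ
    rcases h with rfl | rfl | rfl | rfl
    · exact .inl rfl
    · exact .inr (.inl rfl)
    · exact .inr (.inr (.inl rfl))
    · exact .inr (.inr (.inr (.inl rfl)))
  · exact forces_of_mem renameClosed_IZF (.inl (.inl (.inr ⟨φ, rfl⟩))) s E Γ
  · exact forces_of_mem renameClosed_IZF (hS φ) s E Γ
  · exact forces_strongCollection renameClosed_IZF hS (fun φ => .inr ⟨φ, rfl⟩) φ s E Γ
  · exact forces_subsetCollection renameClosed_IZF hS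
      (.inl (.inl (.inl (.inr (.inr (.inr (.inr rfl))))))) φ s E Γ

theorem isConservativeOver_IGB_IZF : IsConservativeOver IGB IZF := by
  refine isConservativeOver_of_forces renameClosed_IZF
    (fun φ hφ => .inl (.inl ⟨φ, .inr hφ, rfl⟩)) ?_
  rintro ψ ((⟨φ, hφ | hφ, rfl⟩ | rfl | rfl | rfl | rfl) | ⟨φ, hφ, rfl⟩) s E Γ
  · exact forces_IZF_of_mem_CZF hφ s E Γ
  · exact forces_of_mem renameClosed_IZF hφ s E Γ
  · exact forces_classExtensionality renameClosed_IZF s E Γ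
  · exact forces_classSetInduction renameClosed_IZF (fun φ => .inl (.inl (.inr ⟨φ, rfl⟩))) s E Γ
  · exact forces_classSeparation renameClosed_IZF (fun φ => .inl (.inr ⟨φ, rfl⟩)) s E Γ
  · exact forces_classCollection renameClosed_IZF (fun φ => .inr ⟨φ, rfl⟩) s E Γ
  · exact forces_comprehension renameClosed_IZF hφ s E Γ

/-- Falsum and the interpretations of arithmetical sentences are first-order formulas, so
conservativity applies to them directly. -/
theorem IsConservativeOver.sameStrength {S : Set ClassFormula} {T : Set SetFormula}
    (h : IsConservativeOver S T) : SameStrength S T :=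
  ⟨not_congr (h .bot), fun φ => h φ.toSet⟩

end CST

theorem mainTheorem2 :
    (CST.IsConservativeOver CST.IGB CST.IZF ∧ CST.IsConservativeOver CST.CGB CST.CZF) ∧
      (CST.SameStrength CST.IGB CST.IZF ∧ CST.SameStrength CST.CGB CST.CZF) :=
  ⟨⟨CST.isConservativeOver_IGB_IZF, CST.isConservativeOver_CGB_CZF⟩,
    CST.isConservativeOver_IGB_IZF.sameStrength, CST.isConservativeOver_CGB_CZF.sameStrength⟩
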